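/- Fix a plant $x(t+1)=Ax(t)+B_ww(t)+B_uu(t)$, $z(t)=C_zx(t)+D_{zw}w(t)+D_{zu}u(t)$, $y(t)=C_yx(t)+D_{yw}w(t)$ with state in $\mathbb R^{n_x}$ and disturbance in $\mathbb R^{n_w}$, and a linear controller $x_c(t+1)=A_cx_c(t)+B_cy(t)$, $u(t)=C_cx_c(t)+D_cy(t)$ with $x_c(t)\in\mathbb R^{n_x}$. With $\chi=(x,x_c)$, the closed loop is $\chi(t+1)=\mathcal A\chi(t)+\mathcal Bw(t)$, $z(t)=\mathcal C\chi(t)+\mathcal Dw(t)$, $\chi(0)=0$, where $$\mathcal A=\begin{pmatrix}A+B_uD_cC_y&B_uC_c\\B_cC_y&A_c\end{pmatrix},\quad \mathcal B=\begin{pmatrix}B_w+B_uD_cD_{yw}\\B_cD_{yw}\end{pmatrix},\quad \mathcal C=\begin{pmatrix}C_z+D_{zu}D_cC_y&D_{zu}C_c\end{pmatrix},\quad \mathcal D=D_{zw}+D_{zu}D_cD_{yw}.$$ The objective value of a disturbance $w:\mathbb N_0\to L_2(\Omega,\mathbb R^{n_w})$ on a probability space $(\Omega,\mathbb P)$ is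 $J(w)=\limsup_{T\to\infty}\frac1T\sum_{t=0}^{T-1}\mathbb E\|z(t)\|^2\in[0,\infty]$. Let $\mathbb P_{\rm nom}$ be a zero-mean (possibly degenerate) normal distribution on $\mathbb R^{n_w}$, let $\gamma\ge0$, and let $\mathbb W$ be the 2-Wasserstein distance, $\mathbb W(\mathbb P_1,\mathbb P_2)=\inf_\pi(\int\|\xi_1-\xi_2\|^2d\pi)^{1/2}$ over all couplings $\pi$ of $\mathbb P_1,\mathbb P_2$. Original problem: $\mathscr W(\Omega)$ is the set of all $w:\mathbb N_0\to L_2(\Omega,\mathbb R^{n_w})$ with $\mathbb W(\mathbb P_{w(t)},\mathbb P_{\rm nom})\le\gamma$ for all $t$ (case "cor"), or the set of those which in addition are independent over $t$ and have zero mean (case "ind"). Coupling reformulation: $\mathscr F(\Omega)$ is the set of pairs $(w,\hat w)$ of such processes on $\Omega$ with $\mathbb E\|w(t)-\hat w(t)\|^2\le\gamma^2$ and $\mathbb P_{\hat w(t)}=\mathbb P_{\rm nom}$ for all $t$, where in case "ind" $w$ is in addition independent over $t$ with zero mean; the objective value of $(w,\hat w)$ is $J(w)$. Theorem (equivalence of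 Wasserstein and coupling formulations). In each of the two cases and for every separable metric probability space $(\Omega,\mathbb P)$ with its Borel $\sigma$-algebra: (1) If $(w,\hat w)\in\mathscr F(\Omega)$, then $w\in\mathscr W(\Omega)$, with the same objective value. (2) There are a separable metric probability space $(\Omega',\mathbb P')$ with its Borel $\sigma$-algebra and a measure-preserving map $p:\Omega'\to\Omega$ such that (a) there is an injective map $\mathscr W(\Omega)\to\mathscr F(\Omega')$ of the form $w\mapsto(w\circ p,\hat w)$, and it preserves objective values; (b) conversely, every pair $(w',\hat w)\in\mathscr F(\Omega')$ whose disturbance $w'$ is of the form $v\circ p$ for some process $v:\mathbb N_0\to L_2(\Omega,\mathbb R^{n_w})$ has $w'=w\circ p$ for exactly one $w\in\mathscr W(\Omega)$, and the objective values of $w$ and $(w',\hat w)$ agree. Thus feasible disturbances $w$ of the original problem correspond one-to-one to feasible pairs, up to the choice of $\hat w$, with equal objective values. -/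

import Mathlib

open MeasureTheory ProbabilityTheory Filter TopologicalSpace
open scoped ENNReal

universe u

noncomputable section

/-! ### The closed loop of plant and controller -/

/-- System matrices of a generalized plant
`x⁺ = A x + B_w w + B_u u`, `z = C_z x + D_zw w + D_zu u`, `y = C_y x + D_yw w`. -/
structure Plant (nx nw nu nz ny : ℕ) where
  A : Matrix (Fin nx) (Fin nx) ℝ
  Bw : Matrix (Fin nx) (Fin nw) ℝ
  Bu : Matrix (Fin nx) (Fin nu) ℝ
  Cz : Matrix (Fin nz) (Fin nx) ℝ
  Dzw : Matrix (Fin nz) (Fin nw) ℝ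
  Dzu : Matrix (Fin nz) (Fin nu) ℝ
  Cy : Matrix (Fin ny) (Fin nx) ℝ
  Dyw : Matrix (Fin ny) (Fin nw) ℝ

/-- Matrices of a linear controller `x_c⁺ = A_c x_c + B_c y`, `u = C_c x_c + D_c y`. -/
structure Controller (nx nu ny : ℕ) where
  Ac : Matrix (Fin nx) (Fin nx) ℝ
  Bc : Matrix (Fin nx) (Fin ny) ℝ
  Cc : Matrix (Fin nu) (Fin nx) ℝ
  Dc : Matrix (Fin nu) (Fin ny) ℝ

namespace Plant

variable {nx nw nu nz ny : ℕ} (G : Plant nx nw nu nz ny) (K : Controller nx nu ny)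

/-- The closed-loop state matrix `𝒜`, acting on the combined state `χ = (x, x_c)`. -/
def clA : Matrix (Fin nx ⊕ Fin nx) (Fin nx ⊕ Fin nx) ℝ :=
  Matrix.fromBlocks (G.A + G.Bu * K.Dc * G.Cy) (G.Bu * K.Cc) (K.Bc * G.Cy) K.Ac

/-- The closed-loop matrix `ℬ`. -/
def clB : Matrix (Fin nx ⊕ Fin nx) (Fin nw) ℝ :=
  Matrix.fromRows (G.Bw + G.Bu * K.Dc * G.Dyw) (K.Bc * G.Dyw)

/-- The closed-loop matrix `𝒞`. -/
def clC : Matrix (Fin nz) (Fin nx ⊕ Fin nx) ℝ :=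
  Matrix.fromCols (G.Cz + G.Dzu * K.Dc * G.Cy) (G.Dzu * K.Cc)

/-- The closed-loop matrix `𝒟`. -/
def clD : Matrix (Fin nz) (Fin nw) ℝ :=
  G.Dzw + G.Dzu * K.Dc * G.Dyw

end Plant

/-- `RandVec P ι` is the space `L₂(Ω, ℝ^ι)` of square integrable random vectors on the
probability space `(Ω, P)`, where `ℝ^ι` carries the Euclidean norm. -/
abbrev RandVec {Ω : Type u} [MeasurableSpace Ω] (P : Measure Ω) (ι : Type) [Fintype ι] :
    Type u :=
  Lp (EuclideanSpace ℝ ι) 2 P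

/-- The random vector `M ξ`, for a matrix `M` and a random vector `ξ`. -/
def Matrix.mulRandVec {Ω : Type u} [MeasurableSpace Ω] {P : Measure Ω} {ι κ : Type}
    [Fintype ι] [Fintype κ] [DecidableEq ι] (M : Matrix κ ι ℝ) (ξ : RandVec P ι) :
    RandVec P κ :=
  (LinearMap.toContinuousLinearMap (Matrix.toEuclideanLin M)).compLp ξ

section Loop

variable {nx nw nu nz ny : ℕ} {Ω : Type u} [MeasurableSpace Ω] {P : Measure Ω}

/-- The closed-loop state: `χ(0) = 0` and `χ(t+1) = 𝒜 χ(t) + ℬ w(t)`. -/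
def closedLoopState (G : Plant nx nw nu nz ny) (K : Controller nx nu ny)
    (w : ℕ → RandVec P (Fin nw)) : ℕ → RandVec P (Fin nx ⊕ Fin nx)
  | 0 => 0
  | t + 1 => (G.clA K).mulRandVec (closedLoopState G K w t) + (G.clB K).mulRandVec (w t)

/-- The performance output `z(t) = 𝒞 χ(t) + 𝒟 w(t)` of the closed loop. -/
def performanceOutput (G : Plant nx nw nu nz ny) (K : Controller nx nu ny)
    (w : ℕ → RandVec P (Fin nw)) (t : ℕ) : RandVec P (Fin nz) :=
  (G.clC K).mulRandVec (closedLoopState G K w t) + (G.clD K).mulRandVec (w t)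

/-- The objective value `limsup_{T → ∞} (1/T) ∑_{t < T} E ‖z(t)‖²` of a disturbance `w`,
an extended real number (it may be `+∞`). -/
def objective (G : Plant nx nw nu nz ny) (K : Controller nx nu ny)
    (w : ℕ → RandVec P (Fin nw)) : EReal :=
  limsup (fun T : ℕ =>
    (((1 / (T : ℝ)) * ∑ t ∈ Finset.range T,
      ∫ ω, ‖performanceOutput G K w t ω‖ ^ 2 ∂P : ℝ) : EReal)) atTop

end Loop

/-! ### The two disturbance problems -/

/-- The 2-Wasserstein distance of two distributions on `ℝⁿ`: the infimum over all couplings `π`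
of `(∫ ‖ξ₁ - ξ₂‖² dπ(ξ₁, ξ₂))^(1/2)`, as an extended nonnegative number. -/
def wasserstein₂ {n : ℕ} (P₁ P₂ : Measure (EuclideanSpace ℝ (Fin n))) : ℝ≥0∞ :=
  ⨅ π ∈ {π : Measure (EuclideanSpace ℝ (Fin n) × EuclideanSpace ℝ (Fin n)) |
      π.map Prod.fst = P₁ ∧ π.map Prod.snd = P₂},
    (∫⁻ ξ, ‖ξ.1 - ξ.2‖ₑ ^ 2 ∂π) ^ (1 / 2 : ℝ)

/-- The two kinds of disturbances: arbitrarily correlated over time, or independent over time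
with zero mean. -/
inductive DisturbanceKind
  | cor
  | ind

section Problems

variable {nw : ℕ} {Ω : Type u} [MeasurableSpace Ω]

/-- The condition that the kind of disturbance imposes on the process `w`. -/
def DisturbanceKind.Admits (kind : DisturbanceKind) {P : Measure Ω}
    (w : ℕ → RandVec P (Fin nw)) : Prop :=
  match kind with
  | .cor => True
  | .ind => iIndepFun (fun t ω => w t ω) P ∧ ∀ t, ∫ ω, w t ω ∂P = 0

/-- The ambiguity set `𝒲` on the sample space `(Ω, P)`: the disturbances all of whose marginal
laws are within Wasserstein distance `γ` of the nominal law. -/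
def ambiguitySet (kind : DisturbanceKind) (P : Measure Ω)
    (Pnom : Measure (EuclideanSpace ℝ (Fin nw))) (γ : ℝ) : Set (ℕ → RandVec P (Fin nw)) :=
  {w | kind.Admits w ∧ ∀ t, wasserstein₂ (P.map (w t)) Pnom ≤ ENNReal.ofReal γ}

/-- The feasible pairs `(w, ŵ)` of the coupling reformulation on the sample space `(Ω, P)`. -/
def couplingSet (kind : DisturbanceKind) (P : Measure Ω)
    (Pnom : Measure (EuclideanSpace ℝ (Fin nw))) (γ : ℝ) :
    Set ((ℕ → RandVec P (Fin nw)) × (ℕ → RandVec P (Fin nw))) :=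
  {q | kind.Admits q.1 ∧ ∀ t, ∫ ω, ‖q.1 t ω - q.2 t ω‖ ^ 2 ∂P ≤ γ ^ 2 ∧ P.map (q.2 t) = Pnom}

/-- The objective of the coupling reformulation: the auxiliary process `ŵ` does not drive the
closed loop. -/
def couplingObjective {nx nu nz ny : ℕ} {P : Measure Ω} (G : Plant nx nw nu nz ny)
    (K : Controller nx nu ny) (q : (ℕ → RandVec P (Fin nw)) × (ℕ → RandVec P (Fin nw))) :
    EReal :=
  objective G K q.1

/-- The process `w` on `(Ω, P)`, seen as the process `w ∘ p` on an extension
`p : (Ω', P') → (Ω, P)` of the sample space. -/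
def extendProcess {Ω' : Type u} [MeasurableSpace Ω'] {P' : Measure Ω'} {P : Measure Ω}
    {p : Ω' → Ω} (hp : MeasurePreserving p P' P) (w : ℕ → RandVec P (Fin nw)) :
    ℕ → RandVec P' (Fin nw) :=
  fun t => Lp.compMeasurePreserving p hp (w t)

end Problems

end

/-! A feasible pair supplies, at each time, a coupling of cost at most `γ ^ 2`, so (1) is the
definition of the distance. Conversely, an optimal coupling of the law of `w t` and `Pnom` exists
(`exists_coupling_eq_wasserstein₂`), but `Ω` may be too poor to carry the second component. One
independent uniform variable repairs this: on `Ω × [0,1]` the coupling is the joint law of `w t` and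
a function of `w t` and that variable (`exists_measurable_map_prodMk_eq`). The same variable serves
every `t`, because the constraints on `ŵ` concern each time separately. The projection to `Ω`
preserves laws, independence, means and the closed-loop output, so feasibility and objective pass
both ways. -/

/-! ### Optimal couplings -/

section OptimalCoupling

variable {E F : Type*} [TopologicalSpace E] [MeasurableSpace E] [BorelSpace E]
  [TopologicalSpace F] [MeasurableSpace F] [BorelSpace F]

/-- Integration of a continuous `[0, ∞)`-valued function is lower semicontinuous for the weak
topology on probability measures. -/
theorem MeasureTheory.ProbabilityMeasure.lowerSemicontinuous_lintegral {c : E → NNReal}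
    (hc : Continuous c) :
    LowerSemicontinuous fun π : ProbabilityMeasure E => ∫⁻ x, c x ∂(π : Measure E) := by
  -- Truncation at `N` makes the integrand bounded and continuous, hence its integral weakly
  -- continuous; by monotone convergence the functional is a supremum of these.
  have key : (fun π : ProbabilityMeasure E => ∫⁻ x, c x ∂(π : Measure E)) =
      fun π : ProbabilityMeasure E => ⨆ N : ℕ, ∫⁻ x, (min (c x) N : NNReal) ∂(π : Measure E) := by
    funext π
    rw [← lintegral_iSup]
    · refine lintegral_congr fun x => le_antisymm ?_ (iSup_le fun N => ?_)
      · obtain ⟨N, hN⟩ := exists_nat_ge (c x)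
        exact le_iSup_of_le N (by rw [min_eq_left hN])
      · exact_mod_cast min_le_left _ _
    · exact fun N => (hc.min continuous_const).measurable.coe_nnreal_ennreal
    · intro N M h x
      have : (N : NNReal) ≤ M := by exact_mod_cast h
      exact ENNReal.coe_le_coe.2 (min_le_min_left _ this)
  rw [key]
  refine lowerSemicontinuous_iSup fun N => Continuous.lowerSemicontinuous ?_
  let f : BoundedContinuousFunction E NNReal :=
    BoundedContinuousFunction.mkOfBound ⟨fun x => min (c x) N, hc.min continuous_const⟩ N
      (by
        intro x y
        rw [NNReal.dist_eq, abs_le]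
        have hx : ((min (c x) N : NNReal) : ℝ) ≤ N := by exact_mod_cast min_le_right _ _
        have hy : ((min (c y) N : NNReal) : ℝ) ≤ N := by exact_mod_cast min_le_right _ _
        have hx0 := (min (c x) (N : NNReal)).coe_nonneg
        have hy0 := (min (c y) (N : NNReal)).coe_nonneg
        simp only [ContinuousMap.coe_mk]
        constructor <;> linarith)
  exact ProbabilityMeasure.continuous_lintegral_boundedContinuousFunction f

variable [PolishSpace E] [PolishSpace F]

/-- The set of couplings of two probability measures on Polish spaces is weakly compact. -/
theorem isCompact_couplings (μ : Measure E) (ν : Measure F) [IsProbabilityMeasure μ]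
    [IsProbabilityMeasure ν] :
    IsCompact {π : ProbabilityMeasure (E × F) |
      (π : Measure (E × F)).map Prod.fst = μ ∧ (π : Measure (E × F)).map Prod.snd = ν} := by
  set S := {π : ProbabilityMeasure (E × F) |
      (π : Measure (E × F)).map Prod.fst = μ ∧ (π : Measure (E × F)).map Prod.snd = ν}
  -- Taking a marginal is weakly continuous, so prescribing it is a closed condition.
  have hclosed : IsClosed S := by
    let := upgradeIsCompletelyMetrizable E
    let := upgradeIsCompletelyMetrizable F
    have h1 : IsClosed {π : ProbabilityMeasure (E × F) |
        π.map measurable_fst.aemeasurable = ⟨μ, inferInstance⟩} :=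
      isClosed_eq (ProbabilityMeasure.continuous_map continuous_fst) continuous_const
    have h2 : IsClosed {π : ProbabilityMeasure (E × F) |
        π.map measurable_snd.aemeasurable = ⟨ν, inferInstance⟩} :=
      isClosed_eq (ProbabilityMeasure.continuous_map continuous_snd) continuous_const
    have hE : S = {π : ProbabilityMeasure (E × F) |
          π.map measurable_fst.aemeasurable = ⟨μ, inferInstance⟩} ∩
        {π | π.map measurable_snd.aemeasurable = ⟨ν, inferInstance⟩} :=
      Set.ext fun π => ⟨fun h => ⟨Subtype.ext h.1, Subtype.ext h.2⟩,
        fun h => ⟨congrArg Subtype.val h.1, congrArg Subtype.val h.2⟩⟩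
    exact hE ▸ h1.inter h2
  -- A single law on a Polish space is tight, and tight marginals force tight couplings; Prokhorov's
  -- theorem then gives compactness.
  have htight : IsTightMeasureSet {(π : Measure (E × F)) | π ∈ S} := by
    refine IsTightMeasureSet.prodMk (isTightMeasureSet_singleton (μ := μ) |>.subset ?_)
      (isTightMeasureSet_singleton (μ := ν) |>.subset ?_)
    · rintro _ ⟨_, ⟨π, hπ, rfl⟩, rfl⟩
      exact hπ.1
    · rintro _ ⟨_, ⟨π, hπ, rfl⟩, rfl⟩
      exact hπ.2
  rw [← hclosed.closure_eq]
  exact isCompact_closure_of_isTightMeasureSet htight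

end OptimalCoupling

theorem wasserstein₂_le {n : ℕ} {μ ν : Measure (EuclideanSpace ℝ (Fin n))}
    {π : Measure (EuclideanSpace ℝ (Fin n) × EuclideanSpace ℝ (Fin n))}
    (h₁ : π.map Prod.fst = μ) (h₂ : π.map Prod.snd = ν) :
    wasserstein₂ μ ν ≤ (∫⁻ ξ, ‖ξ.1 - ξ.2‖ₑ ^ 2 ∂π) ^ (1 / 2 : ℝ) :=
  iInf₂_le_of_le π ⟨h₁, h₂⟩ le_rfl

/-- The infimum that defines the 2-Wasserstein distance is attained. -/
theorem exists_coupling_eq_wasserstein₂ {n : ℕ} (μ ν : Measure (EuclideanSpace ℝ (Fin n)))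
    [IsProbabilityMeasure μ] [IsProbabilityMeasure ν] :
    ∃ π : Measure (EuclideanSpace ℝ (Fin n) × EuclideanSpace ℝ (Fin n)),
      IsProbabilityMeasure π ∧ π.map Prod.fst = μ ∧ π.map Prod.snd = ν ∧
      (∫⁻ ξ, ‖ξ.1 - ξ.2‖ₑ ^ 2 ∂π) ^ (1 / 2 : ℝ) = wasserstein₂ μ ν := by
  have hne : {π : ProbabilityMeasure (EuclideanSpace ℝ (Fin n) × EuclideanSpace ℝ (Fin n)) |
      (π : Measure (EuclideanSpace ℝ (Fin n) × EuclideanSpace ℝ (Fin n))).map Prod.fst = μ ∧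
      (π : Measure (EuclideanSpace ℝ (Fin n) × EuclideanSpace ℝ (Fin n))).map
        Prod.snd = ν}.Nonempty :=
    ⟨⟨μ.prod ν, inferInstance⟩, show (μ.prod ν).map Prod.fst = μ by simp,
      show (μ.prod ν).map Prod.snd = ν by simp⟩
  have hlsc := ProbabilityMeasure.lowerSemicontinuous_lintegral
    (c := fun ξ : EuclideanSpace ℝ (Fin n) × EuclideanSpace ℝ (Fin n) => ‖ξ.1 - ξ.2‖₊ ^ 2)
    (by fun_prop)
  obtain ⟨π, ⟨hπ₁, hπ₂⟩, hmin⟩ := (hlsc.lowerSemicontinuousOn _).exists_isMinOn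
    hne (isCompact_couplings μ ν)
  refine ⟨π, inferInstance, hπ₁, hπ₂, le_antisymm ?_ (wasserstein₂_le hπ₁ hπ₂)⟩
  · refine le_iInf₂ fun π' hπ' => ENNReal.rpow_le_rpow ?_ (by norm_num)
    -- The infimum ranges over all measures, but a marginal fixes the total mass.
    have : IsProbabilityMeasure π' := by
      have : IsProbabilityMeasure (π'.map Prod.fst) := by rw [hπ'.1]; infer_instance
      exact Measure.isProbabilityMeasure_of_map Prod.fst
    exact_mod_cast hmin (show (⟨π', this⟩ : ProbabilityMeasure _) ∈ _ from hπ')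

/-! ### Realizing couplings on an extension of the sample space -/

/-- A coupling whose first marginal is the law of `X` is the joint law of `X` and some random
variable on the product of the sample space with the unit interval. -/
theorem exists_measurable_map_prodMk_eq {Ω E F : Type*} [MeasurableSpace Ω] [MeasurableSpace E]
    [MeasurableSpace F] [StandardBorelSpace F] [Nonempty F] (P : Measure Ω) [SFinite P]
    {X : Ω → E} (hX : Measurable X) (π : Measure (E × F)) [IsFiniteMeasure π]
    (hπ : π.map Prod.fst = P.map X) :
    ∃ Y : Ω × unitInterval → F, Measurable Y ∧
      (P.prod volume).map (fun ω => (X ω.1, Y ω)) = π := by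
  -- The conditional law of the second coordinate given `x` is the law of `f x U` with `U` uniform,
  -- so `Y = f X U` is the required variable.
  obtain ⟨f, hf, hfκ⟩ := Kernel.exists_measurable_map_eq_unitInterval π.condKernel
  have hg : Measurable fun q : E × unitInterval => (q.1, f q.1 q.2) := measurable_fst.prodMk hf
  refine ⟨fun ω => f (X ω.1) ω.2, hf.comp (by fun_prop : Measurable (Prod.map X id)), ?_⟩
  have h1 : (P.prod (volume : Measure unitInterval)).map (Prod.map X id) = π.fst.prod volume := by
    rw [← Measure.map_prod_map _ _ hX measurable_id, Measure.map_id, ← hπ, Measure.fst]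
  have h2 : (π.fst.prod volume).map (fun q : E × unitInterval => (q.1, f q.1 q.2)) = π := by
    conv_rhs => rw [← π.disintegrate π.condKernel]
    ext s hs
    rw [Measure.map_apply hg hs, Measure.prod_apply (hg hs), Measure.compProd_apply hs]
    refine lintegral_congr fun x => ?_
    rw [← hfκ x, Measure.map_apply hf.of_uncurry_left (measurable_prodMk_left hs)]
    rfl
  rw [← h1, Measure.map_map hg (hX.prodMap measurable_id)] at h2
  exact h2

/-! ### The closed loop on an extension of the sample space -/

section Extension

variable {Ω Ω' : Type u} [MeasurableSpace Ω] [MeasurableSpace Ω'] {P : Measure Ω}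
  {P' : Measure Ω'} {p : Ω' → Ω} (hp : MeasurePreserving p P' P)

theorem MeasureTheory.MeasurePreserving.integral_comp_of_stronglyMeasurable {E : Type*}
    [NormedAddCommGroup E] [NormedSpace ℝ E] (hp : MeasurePreserving p P' P) {f : Ω → E}
    (hf : StronglyMeasurable f) : ∫ ω, f (p ω) ∂P' = ∫ ω, f ω ∂P := by
  rw [← hp.map_eq, integral_map hp.aemeasurable hf.aestronglyMeasurable]

/-- A matrix acts pointwise in `ω`, so it commutes with composition by `p`; by induction the whole
closed-loop trajectory does too. -/
theorem Matrix.mulRandVec_compMeasurePreserving {ι κ : Type} [Fintype ι] [Fintype κ]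
    [DecidableEq ι] (hp : MeasurePreserving p P' P) (M : Matrix κ ι ℝ) (ξ : RandVec P ι) :
    M.mulRandVec (Lp.compMeasurePreserving p hp ξ) =
      Lp.compMeasurePreserving p hp (M.mulRandVec ξ) := by
  refine Lp.ext ?_
  unfold Matrix.mulRandVec
  refine (ContinuousLinearMap.coeFn_compLp' _ _).trans ?_
  refine EventuallyEq.trans ?_ (Lp.coeFn_compMeasurePreserving _ hp).symm
  filter_upwards [Lp.coeFn_compMeasurePreserving ξ hp, hp.quasiMeasurePreserving.ae
    (ContinuousLinearMap.coeFn_compLp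
      (LinearMap.toContinuousLinearMap (Matrix.toEuclideanLin M)) ξ)] with ω h1 h2
  rw [h1, Function.comp_apply, Function.comp_apply, h2]

variable {nx nw nu nz ny : ℕ} (G : Plant nx nw nu nz ny) (K : Controller nx nu ny)
  (w : ℕ → RandVec P (Fin nw))

theorem closedLoopState_extendProcess (t : ℕ) :
    closedLoopState G K (extendProcess hp w) t =
      Lp.compMeasurePreserving p hp (closedLoopState G K w t) := by
  induction t with
  | zero => exact (map_zero _).symm
  | succ t ih =>
    simp only [closedLoopState, ih, extendProcess, Matrix.mulRandVec_compMeasurePreserving,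
      map_add]

theorem performanceOutput_extendProcess (t : ℕ) :
    performanceOutput G K (extendProcess hp w) t =
      Lp.compMeasurePreserving p hp (performanceOutput G K w t) := by
  simp only [performanceOutput, closedLoopState_extendProcess]
  simp only [extendProcess, Matrix.mulRandVec_compMeasurePreserving, map_add]

/-- Passing to an extension of the sample space does not change the objective value. -/
theorem objective_extendProcess : objective G K (extendProcess hp w) = objective G K w := by
  have h (t : ℕ) : ∫ ω, ‖performanceOutput G K (extendProcess hp w) t ω‖ ^ 2 ∂P' =
      ∫ ω, ‖performanceOutput G K w t ω‖ ^ 2 ∂P := by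
    have hm : StronglyMeasurable fun ω => ‖performanceOutput G K w t ω‖ ^ 2 :=
      (Lp.stronglyMeasurable _).norm.pow 2
    rw [performanceOutput_extendProcess, ← hp.integral_comp_of_stronglyMeasurable hm]
    refine integral_congr_ae ?_
    filter_upwards [Lp.coeFn_compMeasurePreserving (performanceOutput G K w t) hp] with ω hω
    rw [hω, Function.comp_apply]
  simp only [objective, h]

theorem extendProcess_injective :
    Function.Injective (extendProcess hp : (ℕ → RandVec P (Fin nw)) → _) := by
  intro v w h
  funext t
  exact (Lp.isometry_compMeasurePreserving hp).injective (congrFun h t)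

theorem coeFn_extendProcess (t : ℕ) : extendProcess hp w t =ᵐ[P'] w t ∘ p :=
  Lp.coeFn_compMeasurePreserving _ hp

theorem map_extendProcess (t : ℕ) : P'.map (extendProcess hp w t) = P.map (w t) := by
  rw [Measure.map_congr (coeFn_extendProcess hp w t)]
  exact (((Lp.stronglyMeasurable (w t)).measurable.measurePreserving P).comp hp).map_eq

/-- Independence is a family of identities between probabilities of events of `w`, and pulling
events back along `p` keeps their probabilities. -/
theorem DisturbanceKind.admits_extendProcess_iff (kind : DisturbanceKind) :
    kind.Admits (extendProcess hp w) ↔ kind.Admits w := by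
  cases kind with
  | cor => exact Iff.rfl
  | ind =>
    refine and_congr ?_ (forall_congr' fun t => ?_)
    · rw [iIndepFun_congr (coeFn_extendProcess hp w),
        iIndepFun_iff_measure_inter_preimage_eq_mul, iIndepFun_iff_measure_inter_preimage_eq_mul]
      refine forall_congr' fun S => forall_congr' fun s => forall_congr' fun hs => ?_
      have hm (i : ℕ) (hi : i ∈ S) : MeasurableSet ((w i : Ω → _) ⁻¹' s i) :=
        (Lp.stronglyMeasurable (w i)).measurable (hs i hi)
      have h1 : ⋂ i ∈ S, (w i ∘ p) ⁻¹' s i = p ⁻¹' ⋂ i ∈ S, (w i : Ω → _) ⁻¹' s i := by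
        simp only [Set.preimage_iInter, Set.preimage_comp]
      rw [h1, hp.measure_preimage (S.measurableSet_biInter hm).nullMeasurableSet]
      rw [Finset.prod_congr rfl fun i hi => by
        rw [Set.preimage_comp, hp.measure_preimage (hm i hi).nullMeasurableSet]]
    · rw [integral_congr_ae (coeFn_extendProcess hp w t),
        ← hp.integral_comp_of_stronglyMeasurable (Lp.stronglyMeasurable (w t))]
      rfl

theorem extendProcess_mem_ambiguitySet_iff (kind : DisturbanceKind)
    (Pnom : Measure (EuclideanSpace ℝ (Fin nw))) (γ : ℝ) :
    extendProcess hp w ∈ ambiguitySet kind P' Pnom γ ↔ w ∈ ambiguitySet kind P Pnom γ := by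
  simp only [ambiguitySet, Set.mem_ofPred_eq, DisturbanceKind.admits_extendProcess_iff,
    map_extendProcess]

end Extension

/-! ### Feasible disturbances and feasible pairs -/

section Feasible

variable {nw : ℕ} {Ω : Type u} [MeasurableSpace Ω] {P : Measure Ω}

/-- Links the cost in `wasserstein₂` to the one in `couplingSet`; square integrability rules out the
default value `0` of the Bochner integral. -/
theorem lintegral_enorm_sub_sq {n : ℕ} (ξ η : RandVec P (Fin n)) :
    ∫⁻ ω, ‖ξ ω - η ω‖ₑ ^ 2 ∂P = ENNReal.ofReal (∫ ω, ‖ξ ω - η ω‖ ^ 2 ∂P) := by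
  have hL : MemLp (fun ω => ξ ω - η ω) 2 P := (Lp.memLp ξ).sub (Lp.memLp η)
  rw [ofReal_integral_eq_lintegral_ofReal (hL.integrable_norm_pow (by norm_num))
    (ae_of_all _ fun ω => by positivity)]
  refine lintegral_congr fun ω => ?_
  rw [ENNReal.ofReal_pow (norm_nonneg _), ofReal_norm]

/-- The disturbance of a feasible pair is feasible. -/
theorem fst_mem_ambiguitySet {kind : DisturbanceKind}
    {Pnom : Measure (EuclideanSpace ℝ (Fin nw))} {γ : ℝ} (hγ : 0 ≤ γ)
    {q : (ℕ → RandVec P (Fin nw)) × (ℕ → RandVec P (Fin nw))}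
    (hq : q ∈ couplingSet kind P Pnom γ) : q.1 ∈ ambiguitySet kind P Pnom γ := by
  refine ⟨hq.1, fun t => ?_⟩
  have hm₁ : Measurable (q.1 t) := (Lp.stronglyMeasurable _).measurable
  have hm₂ : Measurable (q.2 t) := (Lp.stronglyMeasurable _).measurable
  have hm := hm₁.prodMk hm₂
  have hπ : (P.map fun ω => (q.1 t ω, q.2 t ω)).map Prod.fst = P.map (q.1 t) ∧
      (P.map fun ω => (q.1 t ω, q.2 t ω)).map Prod.snd = Pnom := by
    rw [Measure.map_map measurable_fst hm, Measure.map_map measurable_snd hm]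
    exact ⟨rfl, (hq.2 t).2⟩
  refine (wasserstein₂_le hπ.1 hπ.2).trans ?_
  rw [lintegral_map (by fun_prop) hm, lintegral_enorm_sub_sq]
  refine (ENNReal.rpow_le_rpow (ENNReal.ofReal_le_ofReal (hq.2 t).1) (by norm_num)).trans ?_
  rw [ENNReal.ofReal_rpow_of_nonneg (by positivity) (by norm_num), ← Real.sqrt_eq_rpow,
    Real.sqrt_sq hγ]

/-- On the product of the sample space with the unit interval, every feasible disturbance is
completed to a feasible pair. -/
theorem exists_mem_couplingSet [IsProbabilityMeasure P] {kind : DisturbanceKind}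
    {Pnom : Measure (EuclideanSpace ℝ (Fin nw))} [IsProbabilityMeasure Pnom]
    (hnom : MemLp id 2 Pnom) {γ : ℝ} (hγ : 0 ≤ γ) {w : ℕ → RandVec P (Fin nw)}
    (hw : w ∈ ambiguitySet kind P Pnom γ) :
    ∃ v, (extendProcess (measurePreserving_fst (μ := P) (ν := (volume : Measure unitInterval))) w,
      v) ∈ couplingSet kind (P.prod (volume : Measure unitInterval)) Pnom γ := by
  set hp := measurePreserving_fst (μ := P) (ν := (volume : Measure unitInterval))
  have key (t : ℕ) : ∃ η : RandVec (P.prod (volume : Measure unitInterval)) (Fin nw),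
      ∫ ω, ‖(extendProcess hp w t) ω - η ω‖ ^ 2 ∂(P.prod volume) ≤ γ ^ 2 ∧
        (P.prod volume).map η = Pnom := by
    have hX : Measurable (w t) := (Lp.stronglyMeasurable _).measurable
    have : IsProbabilityMeasure (P.map (w t)) := Measure.isProbabilityMeasure_map hX.aemeasurable
    obtain ⟨π, _, hπ₁, hπ₂, hπ⟩ := exists_coupling_eq_wasserstein₂ (P.map (w t)) Pnom
    obtain ⟨Y, hY, hXY⟩ := exists_measurable_map_prodMk_eq P hX π hπ₁
    have hm : Measurable fun ω : Ω × unitInterval => (w t ω.1, Y ω) :=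
      (hX.comp measurable_fst).prodMk hY
    have hlaw : (P.prod volume).map Y = Pnom := by
      rw [← hπ₂, ← hXY, Measure.map_map measurable_snd hm]; rfl
    -- Being in `L₂` depends on the law alone, so the second moment of `Pnom` suffices.
    have hYL : MemLp Y 2 (P.prod volume) := by
      rw [← hlaw] at hnom
      exact hnom.comp_of_map hY.aemeasurable
    refine ⟨hYL.toLp Y, ?_, by rw [Measure.map_congr hYL.coeFn_toLp, hlaw]⟩
    rw [← ENNReal.ofReal_le_ofReal_iff (by positivity), ← lintegral_enorm_sub_sq]
    have h1 : ∫⁻ ω, ‖(extendProcess hp w t) ω - hYL.toLp Y ω‖ₑ ^ 2 ∂(P.prod volume) =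
        ∫⁻ ξ, ‖ξ.1 - ξ.2‖ₑ ^ 2 ∂π := by
      rw [← hXY, lintegral_map (by fun_prop) hm]
      refine lintegral_congr_ae ?_
      filter_upwards [coeFn_extendProcess hp w t, hYL.coeFn_toLp] with ω h1 h2
      rw [h1, h2, Function.comp_apply]
    have h2 := hw.2 t
    rw [← hπ] at h2
    rw [h1, ENNReal.ofReal_pow hγ]
    calc ∫⁻ ξ, ‖ξ.1 - ξ.2‖ₑ ^ 2 ∂π
        = ((∫⁻ ξ, ‖ξ.1 - ξ.2‖ₑ ^ 2 ∂π) ^ (1 / 2 : ℝ)) ^ 2 := by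
          rw [← ENNReal.rpow_natCast, ← ENNReal.rpow_mul]; norm_num
      _ ≤ ENNReal.ofReal γ ^ 2 := pow_le_pow_left' h2 2
  choose v hv using key
  exact ⟨v, (kind.admits_extendProcess_iff hp w).2 hw.1, hv⟩

end Feasible

theorem mainTheorem6 {nx nw nu nz ny : ℕ}
    (G : Plant nx nw nu nz ny) (K : Controller nx nu ny)
    (Pnom : Measure (EuclideanSpace ℝ (Fin nw))) [IsGaussian Pnom]
    (hmean : ∫ v, v ∂Pnom = 0) (γ : ℝ) (hγ : 0 ≤ γ) (kind : DisturbanceKind)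
    (Ω : Type u) [MetricSpace Ω] [SeparableSpace Ω] [MeasurableSpace Ω] [BorelSpace Ω]
    (P : Measure Ω) [IsProbabilityMeasure P] :
    -- the disturbance of a feasible pair is feasible, with the same objective value
    (∀ q ∈ couplingSet kind P Pnom γ,
      q.1 ∈ ambiguitySet kind P Pnom γ ∧ objective G K q.1 = couplingObjective G K q) ∧
    -- on an extension of the sample space, which serves all disturbances at once,
    ∃ (Ω' : Type u) (_ : MetricSpace Ω') (_ : SeparableSpace Ω') (_ : MeasurableSpace Ω')
      (_ : BorelSpace Ω') (P' : Measure Ω') (_ : IsProbabilityMeasure P')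
      (p : Ω' → Ω) (hp : MeasurePreserving p P' P),
      -- each feasible disturbance is completed to a feasible pair, one-to-one,
      (∃ Φ : ambiguitySet kind P Pnom γ → couplingSet kind P' Pnom γ,
        Function.Injective Φ ∧
        ∀ w, (Φ w).1.1 = extendProcess hp w.1 ∧
          couplingObjective G K (Φ w).1 = objective G K w.1) ∧
      -- and each feasible pair whose disturbance lives on the original sample space
      -- arises from exactly one feasible disturbance, with the same objective value
      ∀ q ∈ couplingSet kind P' Pnom γ, q.1 ∈ Set.range (extendProcess hp) →
        ∃! w : ℕ → RandVec P (Fin nw), extendProcess hp w = q.1 ∧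
          w ∈ ambiguitySet kind P Pnom γ ∧ objective G K w = couplingObjective G K q := by
  refine ⟨fun q hq => ⟨fst_mem_ambiguitySet hγ hq, rfl⟩, Ω × unitInterval, inferInstance,
    inferInstance, inferInstance, ?_⟩
  -- Second countability makes the product σ-algebra on `Ω × unitInterval` the Borel one.
  have : SecondCountableTopology Ω := UniformSpace.secondCountable_of_separable Ω
  refine ⟨inferInstance, P.prod volume, inferInstance, Prod.fst, measurePreserving_fst, ?_, ?_⟩
  · choose v hv using fun w : ambiguitySet kind P Pnom γ =>
      exists_mem_couplingSet (IsGaussian.memLp_two_id (μ := Pnom)) hγ w.2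
    refine ⟨fun w => ⟨_, hv w⟩, fun w₁ w₂ h => ?_, fun w => ⟨rfl, objective_extendProcess _ G K _⟩⟩
    -- The first component alone determines `w`, whatever `ŵ` was chosen.
    exact Subtype.ext (extendProcess_injective _ (congrArg (fun q => q.1.1) h))
  · rintro ⟨_, v⟩ hq ⟨w, rfl⟩
    -- Part (1) applies on the extension, and feasibility then descends to `Ω`.
    exact ⟨w, ⟨rfl, (extendProcess_mem_ambiguitySet_iff _ w kind Pnom γ).1
      (fst_mem_ambiguitySet hγ hq), (objective_extendProcess _ G K w).symm⟩,
      fun w' hw' => extendProcess_injective _ hw'.1⟩
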